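/- Let $d > 2$ be an integer. A weak type-$d$ surgery on a closed oriented $3$-manifold is $\frac{q}{ds}$ Dehn surgery along a simple closed curve, with respect to some meridian and longitude on the boundary of a solid torus neighbourhood of the curve, where $q$ and $s$ are integers with $q$ relatively prime to both $d$ and $s$; that is, a solid torus neighbourhood of the curve is removed and a solid torus is glued back so that its meridian is identified with a curve running $q$ times along the old meridian and $ds$ times along the old longitude. Weak $d$-congruence is the equivalence relation on closed oriented $3$-manifolds (considered up to orientation-preserving diffeomorphism) generated by weak type-$d$ surgery, with $d$ fixed and $q$, $s$ and the curve allowed to vary. Then the $3$-torus $T^3 = S^1\times S^1\times S^1$ is not weakly $d$-congruent to the connected sum $\#^3\, S^1\times S^2$ of three copies of $S^1\times S^2$, whatever the orientations. -/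

import Mathlib

open Set Topology
open scoped Manifold ContDiff

noncomputable section

/-- Three-dimensional Euclidean space. -/
abbrev E3 : Type := EuclideanSpace ℝ (Fin 3)

/-- Smooth maps `f` on `s ⊆ ℝ³` whose Jacobian determinant is positive at every point of `s`. -/
def orientedPregroupoid : Pregroupoid E3 where
  property f s := ContDiffOn ℝ ∞ f s ∧ ∀ x ∈ s, 0 < (fderiv ℝ f x).det
  comp := by
    rintro f g u v ⟨hf, hf'⟩ ⟨hg, hg'⟩ hu hv huv
    refine ⟨hg.comp (hf.mono inter_subset_left) (fun x hx => hx.2), ?_⟩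
    rintro x ⟨hxu, hxv⟩
    have dg : DifferentiableAt ℝ g (f x) :=
      (hg.contDiffAt (hv.mem_nhds hxv)).differentiableAt (by simp)
    have df : DifferentiableAt ℝ f x :=
      (hf.contDiffAt (hu.mem_nhds hxu)).differentiableAt (by simp)
    rw [fderiv_comp x dg df]
    have : ((fderiv ℝ g (f x)).comp (fderiv ℝ f x)).det
        = (fderiv ℝ g (f x)).det * (fderiv ℝ f x).det := by
      simp only [ContinuousLinearMap.det]
      exact LinearMap.det_comp _ _
    rw [this]
    exact mul_pos (hg' _ hxv) (hf' _ hxu)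
  id_mem := by
    refine ⟨contDiff_id.contDiffOn, fun x _ => ?_⟩
    rw [fderiv_id]
    simp [ContinuousLinearMap.det]
  locality := by
    intro f u hu h
    refine ⟨fun x hx => ?_, fun x hx => ?_⟩
    · obtain ⟨v, hv, hxv, h1, -⟩ := h x hx
      exact (h1.contDiffAt ((hu.inter hv).mem_nhds ⟨hx, hxv⟩)).contDiffWithinAt
    · obtain ⟨v, hv, hxv, -, h2⟩ := h x hx
      exact h2 x ⟨hx, hxv⟩
  congr := by
    rintro f g u hu h ⟨h1, h2⟩
    refine ⟨h1.congr h, fun x hx => ?_⟩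
    have : g =ᶠ[𝓝 x] f := by
      filter_upwards [hu.mem_nhds hx] with y hy using h y hy
    rw [this.fderiv_eq]
    exact h2 x hx

/-- The groupoid of orientation-preserving smooth diffeomorphisms between open subsets of `ℝ³`. -/
def orientedGroupoid : StructureGroupoid E3 :=
  orientedPregroupoid.groupoid

/-- A closed oriented (smooth) 3-manifold: a compact Hausdorff space with an oriented smooth atlas,
that is, an atlas modelled on `ℝ³` whose transition maps are smooth with positive Jacobian
determinant. The orientation is the one in which all the charts preserve orientation. -/
structure ClosedOriented3Manifold where
  carrier : Type
  [topology : TopologicalSpace carrier]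
  [t2 : T2Space carrier]
  [compact : CompactSpace carrier]
  [charted : ChartedSpace E3 carrier]
  [oriented : HasGroupoid carrier orientedGroupoid]

namespace ClosedOriented3Manifold

instance : CoeSort ClosedOriented3Manifold Type := ⟨carrier⟩

instance (M : ClosedOriented3Manifold) : TopologicalSpace M := M.topology

instance (M : ClosedOriented3Manifold) : T2Space M := M.t2

instance (M : ClosedOriented3Manifold) : CompactSpace M := M.compact

instance (M : ClosedOriented3Manifold) : ChartedSpace E3 M := M.charted

instance (M : ClosedOriented3Manifold) : HasGroupoid M orientedGroupoid := M.oriented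

/-- `h` is an orientation-preserving diffeomorphism from the open set `h.source ⊆ M` onto the open
set `h.target ⊆ N`: read in the charts, it lies in the oriented groupoid. -/
def IsOrientedPartialDiffeo {M N : ClosedOriented3Manifold} (h : OpenPartialHomeomorph M N) :
    Prop :=
  ∀ c ∈ atlas E3 M, ∀ c' ∈ atlas E3 N, c.symm ≫ₕ h ≫ₕ c' ∈ orientedGroupoid

/-- `M` and `N` are diffeomorphic by an orientation-preserving diffeomorphism. -/
def OrientedDiffeomorphic (M N : ClosedOriented3Manifold) : Prop :=
  Nonempty (Structomorph orientedGroupoid M N)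

/-- A smooth open embedding of the open solid torus `ℂ × S¹` in `M`, that is, an open tubular
neighbourhood of the simple closed curve `f (0 × S¹)` with a parametrization. The curve
`u ↦ f (u, 1)` is a meridian, and the curve `v ↦ f (1, v)` is a longitude. -/
def IsSolidTorusEmbedding {M : ClosedOriented3Manifold} (f : ℂ × Circle → M) : Prop :=
  Function.Injective f ∧ IsLocalDiffeomorph (𝓘(ℝ, ℂ).prod (𝓡 1)) (𝓡 3) ∞ f

/-- The core of an embedded solid torus (the surgery curve). -/
def core {M : ClosedOriented3Manifold} (f : ℂ × Circle → M) : Set M :=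
  f '' ({0} ×ˢ univ)

/-- `M'` is the result of `q / p` Dehn surgery along some simple closed curve in `M`, with respect to
some meridian-longitude pair.

That is, `M'` is got from the complement of the core of a solid torus `f` in `M` by gluing in
another solid torus `f'` so that the new meridian `u ↦ (u, 1)` is identified with the curve
`u ↦ (u ^ q, u ^ p)`, which runs `q` times along the old meridian and `p` times along the old
longitude. The gluing map is the linear automorphism of `S¹ × S¹` with the matrix
`!![q, b; p, e]` of determinant `±1`, and it preserves the distance `r` to the core.
The orientations of `M` and `M'` agree on the common complement. -/
def IsDehnSurgery (q p : ℤ) (M M' : ClosedOriented3Manifold) : Prop :=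
  ∃ (f : ℂ × Circle → M) (f' : ℂ × Circle → M') (h : OpenPartialHomeomorph M M') (b e : ℤ),
    IsSolidTorusEmbedding f ∧ IsSolidTorusEmbedding f' ∧
    IsOrientedPartialDiffeo h ∧ h.source = (core f)ᶜ ∧ h.target = (core f')ᶜ ∧
    (q * e - b * p = 1 ∨ q * e - b * p = -1) ∧
    ∀ (r : ℝ) (u v : Circle), 0 < r →
      h (f ((r : ℂ) * ((u ^ q * v ^ b : Circle) : ℂ), u ^ p * v ^ e)) = f' ((r : ℂ) * (u : ℂ), v)

/-- Weak type-`d` surgery: `q / (d s)` Dehn surgery along a simple closed curve, where `q` is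
relatively prime to `d` and to `s`. -/
def IsWeakTypeSurgery (d : ℕ) (M M' : ClosedOriented3Manifold) : Prop :=
  ∃ q s : ℤ, IsCoprime q (d : ℤ) ∧ IsCoprime q s ∧ IsDehnSurgery q (d * s) M M'

/-- Weak `d`-congruence: the equivalence relation on closed oriented 3-manifolds (considered up to
orientation-preserving diffeomorphism) generated by weak type-`d` surgery. -/
def WeaklyCongruent (d : ℕ) : ClosedOriented3Manifold → ClosedOriented3Manifold → Prop :=
  Relation.EqvGen fun M M' => OrientedDiffeomorphic M M' ∨ IsWeakTypeSurgery d M M'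

/-- A smooth open embedding of `ℝ³` in `M`. -/
def IsBallEmbedding {M : ClosedOriented3Manifold} (f : E3 → M) : Prop :=
  Function.Injective f ∧ IsLocalDiffeomorph (𝓡 3) (𝓡 3) ∞ f

/-- `P` is an (oriented) connected sum of `M₁` and `M₂`: it is the union of copies `g₁`, `g₂` of
`M₁ ∖ f₁ 0` and `M₂ ∖ f₂ 0`, where `f₁`, `f₂` are embedded open balls, which overlap precisely in
`f₁ (ℝ³ ∖ 0)`, identified with `f₂ (ℝ³ ∖ 0)` by the inversion `x ↦ x / ‖x‖²`. The inclusions `g₁`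
and `g₂` preserve orientation; as inversion reverses it, exactly one of `f₁` and `f₂` does so too. -/
def IsConnectedSum (M₁ M₂ P : ClosedOriented3Manifold) : Prop :=
  ∃ (f₁ : E3 → M₁) (f₂ : E3 → M₂) (g₁ : OpenPartialHomeomorph M₁ P)
    (g₂ : OpenPartialHomeomorph M₂ P),
    IsBallEmbedding f₁ ∧ IsBallEmbedding f₂ ∧
    IsOrientedPartialDiffeo g₁ ∧ IsOrientedPartialDiffeo g₂ ∧
    g₁.source = {f₁ 0}ᶜ ∧ g₂.source = {f₂ 0}ᶜ ∧
    g₁.target ∪ g₂.target = univ ∧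
    g₁.target ∩ g₂.target = (fun x => g₁ (f₁ x)) '' {0}ᶜ ∧
    ∀ x : E3, x ≠ 0 → g₁ (f₁ x) = g₂ (f₂ ((‖x‖ ^ 2)⁻¹ • x))

/-- `M` is the 3-torus `T³ = S¹ × S¹ × S¹`, with any orientation. -/
def IsThreeTorus (M : ClosedOriented3Manifold) : Prop :=
  Nonempty (M ≃ₜ Circle × Circle × Circle)

/-- `M` is `S¹ × S²`, with any orientation. -/
def IsS1xS2 (M : ClosedOriented3Manifold) : Prop :=
  Nonempty (M ≃ₜ Circle × Metric.sphere (0 : E3) 1)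

/-- `N` is the connected sum of three copies of `S¹ × S²`. -/
def IsTripleConnectedSumS1xS2 (N : ClosedOriented3Manifold) : Prop :=
  ∃ X₁ X₂ X₃ Y : ClosedOriented3Manifold, IsS1xS2 X₁ ∧ IsS1xS2 X₂ ∧ IsS1xS2 X₃ ∧
    IsConnectedSum X₁ X₂ Y ∧ IsConnectedSum Y X₃ N

end ClosedOriented3Manifold

end

/-! Fix a noncommutative group `G` of exponent dividing `d`, which exists because `d > 2`. The
invariant is whether the fundamental group has a homomorphism to `G` with noncommutative image. It
holds for a connected sum of copies of `S¹ × S²`, whose group is free of rank at least two, and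
fails for the torus, whose group is abelian.

For surgery, homomorphisms from the group of `M` are those from the group of the curve complement
that kill the meridian `μ`. The new meridian is `μ ^ q * λ ^ (d * s)`, and `λ ^ (d * s)` dies in
`G`, so such a homomorphism also factors through the group of `M'`. Its image is unchanged, since
the group of the complement surjects onto both groups. The inverse gluing matrix gives the converse.

Homomorphisms are replaced by `G`-valued Alexander–Spanier cocycles, conjugation by gauge
transformations, and the image by a subgroup to which the cocycle reduces. No base points or van
Kampen theorem are then needed: `exists_glue` builds cocycles from pieces,
`IsCocycleOn.trivializedBy` computes on simply connected covers, and `ReducedOn.exists_extend`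
expresses the surjectivity from the complement. The two surgery directions rest on
`HasNonabelianCocycle.of_surgery`. -/

/-! ### Alexander–Spanier cocycles with values in a group -/

namespace LocalSystem

open Filter

variable {X Y B G : Type*} [TopologicalSpace X] [TopologicalSpace Y] [TopologicalSpace B] [Group G]

/-- Near the diagonal of `S`, the function `c` is the coboundary of `F`. -/
def TrivializedBy (c : X → X → G) (F : X → G) (S : Set X) : Prop :=
  ∀ x ∈ S, ∀ᶠ p in 𝓝 (x, x), c p.1 p.2 = (F p.1)⁻¹ * F p.2

/-- A (not necessarily continuous) Alexander–Spanier `1`-cocycle on `S`: near each point of `S`,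
it is the coboundary of some function. -/
def IsCocycleOn (c : X → X → G) (S : Set X) : Prop :=
  ∀ x ∈ S, ∃ φ : X → G, ∀ᶠ p in 𝓝 (x, x), c p.1 p.2 = (φ p.1)⁻¹ * φ p.2

/-- The gauge transform of `c` by `k`. -/
def gauge (c : X → X → G) (k : X → G) (x y : X) : G := (k x)⁻¹ * c x y * k y

/-- Near the diagonal of `S`, the gauge transform of `c` by `k` takes values in `A`. -/
def ReducedOn (c : X → X → G) (k : X → G) (A : Subgroup G) (S : Set X) : Prop :=
  ∀ x ∈ S, ∀ᶠ p in 𝓝 (x, x), gauge c k p.1 p.2 ∈ A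

variable (G X) in
/-- There is a `G`-valued cocycle on `X` that is not gauge equivalent to a cocycle with values in
a commutative subgroup. -/
def HasNonabelianCocycle : Prop :=
  ∃ c : X → X → G, IsCocycleOn c univ ∧
    ∀ (k : X → G) (A : Subgroup G), (∀ a ∈ A, ∀ b ∈ A, a * b = b * a) → ¬ ReducedOn c k A univ

/-! ### Germs along the diagonal; pullback and gauge change of cocycles -/

theorem eventually_diag_comp {g : Y → X} {y : Y} (hg : ContinuousAt g y) {P : X × X → Prop}
    (h : ∀ᶠ p in 𝓝 (g y, g y), P p) : ∀ᶠ p in 𝓝 (y, y), P (g p.1, g p.2) :=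
  (hg.prodMap hg).eventually h

theorem eventually_diag_of_isOpenMap {g : Y → X} (hg : IsOpenMap g) {y : Y} {P : X × X → Prop}
    (h : ∀ᶠ p in 𝓝 (y, y), P (g p.1, g p.2)) : ∀ᶠ p in 𝓝 (g y, g y), P p :=
  (hg.prodMap hg).nhds_le (y, y) h

theorem eventually_of_diag {x : X} {P : X × X → Prop} (h : ∀ᶠ p in 𝓝 (x, x), P p) :
    ∀ᶠ y in 𝓝 x, P (x, y) :=
  (ContinuousAt.tendsto (f := fun y : X => (x, y)) (by fun_prop)).eventually h

theorem eventually_diag_mem {x : X} {S : Set X} (hS : S ∈ 𝓝 x) :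
    ∀ᶠ p in 𝓝 (x, x), p.1 ∈ S ∧ p.2 ∈ S := by
  rw [nhds_prod_eq]
  exact prod_mem_prod hS hS

theorem eq_of_eventually_eq {α : Type*} {S : Set X} (hS : IsPreconnected S) {f : X → α}
    (h : ∀ x ∈ S, ∀ᶠ y in 𝓝 x, f y = f x) {x y : X} (hx : x ∈ S) (hy : y ∈ S) : f x = f y := by
  let _ : TopologicalSpace α := ⊥
  have _ : DiscreteTopology α := ⟨rfl⟩
  refine hS.constant (fun z hz => ?_) hx hy
  apply ContinuousAt.continuousWithinAt
  unfold ContinuousAt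
  rw [nhds_discrete α]
  exact tendsto_pure.2 (h z hz)

theorem IsCocycleOn.comp {c : X → X → G} {S : Set X} (hc : IsCocycleOn c S) {g : Y → X} {T : Set Y}
    (hg : ∀ y ∈ T, ContinuousAt g y) (hT : ∀ y ∈ T, g y ∈ S) :
    IsCocycleOn (fun y z => c (g y) (g z)) T := fun y hy => by
  obtain ⟨φ, hφ⟩ := hc _ (hT y hy)
  exact ⟨φ ∘ g, eventually_diag_comp (hg y hy) hφ⟩

theorem IsCocycleOn.gauge {c : X → X → G} {S : Set X} (hc : IsCocycleOn c S) (k : X → G) :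
    IsCocycleOn (gauge c k) S := fun x hx => by
  obtain ⟨φ, hφ⟩ := hc x hx
  refine ⟨fun y => φ y * k y, hφ.mono fun p hp => ?_⟩
  simp only [LocalSystem.gauge, hp]
  group

theorem IsCocycleOn.congr {c c' : X → X → G} {S : Set X} (hc : IsCocycleOn c S)
    (h : ∀ x ∈ S, ∀ᶠ p in 𝓝 (x, x), c' p.1 p.2 = c p.1 p.2) : IsCocycleOn c' S := fun x hx => by
  obtain ⟨φ, hφ⟩ := hc x hx
  exact ⟨φ, by filter_upwards [hφ, h x hx] with p h1 h2; rw [h2, h1]⟩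

theorem isCocycleOn_one (S : Set X) : IsCocycleOn (fun _ _ => (1 : G)) S := fun _ _ =>
  ⟨fun _ => 1, by simp⟩

theorem reducedOn_gauge {c : X → X → G} {k l : X → G} {A : Subgroup G} {S : Set X} :
    ReducedOn (gauge c k) l A S ↔ ReducedOn c (fun x => k x * l x) A S := by
  have : ∀ x y, gauge (gauge c k) l x y = gauge c (fun x => k x * l x) x y := fun x y => by
    simp only [gauge]; group
  simp only [ReducedOn, this]

theorem ReducedOn.comp {c : X → X → G} {k : X → G} {A : Subgroup G} {S : Set X}
    (hk : ReducedOn c k A S) {g : Y → X} {T : Set Y} (hg : ∀ y ∈ T, ContinuousAt g y)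
    (hT : ∀ y ∈ T, g y ∈ S) : ReducedOn (fun y z => c (g y) (g z)) (k ∘ g) A T := fun y hy =>
  eventually_diag_comp (hg y hy) (hk _ (hT y hy))

theorem ReducedOn.congr {c c' : X → X → G} {k : X → G} {A : Subgroup G} {S : Set X}
    (hk : ReducedOn c k A S) (h : ∀ x ∈ S, ∀ᶠ p in 𝓝 (x, x), c' p.1 p.2 = c p.1 p.2) :
    ReducedOn c' k A S := fun x hx => by
  filter_upwards [hk x hx, h x hx] with p h1 h2
  simpa only [gauge, h2] using h1

theorem ReducedOn.of_openPartialHomeomorph {c : X → X → G} {c' : Y → Y → G}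
    {h : OpenPartialHomeomorph X Y}
    (hc : ∀ y ∈ h.target, ∀ᶠ p in 𝓝 (y, y), c' p.1 p.2 = c (h.symm p.1) (h.symm p.2))
    {k : Y → G} {A : Subgroup G} (hk : ReducedOn c' k A univ) :
    ReducedOn c (k ∘ h) A h.source := by
  refine ReducedOn.congr (c := fun x y => c' (h x) (h y))
    (hk.comp (fun y hy => h.continuousAt hy) (fun _ _ => mem_univ _)) fun x hx => ?_
  filter_upwards [eventually_diag_comp (h.continuousAt hx) (hc (h x) (h.map_source hx)),
    eventually_diag_mem (h.open_source.mem_nhds hx)] with y hy hys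
  rw [hy, h.left_inv hys.1, h.left_inv hys.2]

/-! ### Trivialization, gluing and extension of reductions -/

/-- A cocycle on a simply connected space is trivial: the covering space of germs of its
trivializations has a section. -/
theorem IsCocycleOn.trivializedBy [SimplyConnectedSpace X] [LocallyPathConnectedSpace X]
    {c : X → X → G} (hc : IsCocycleOn c univ) : ∃ F : X → G, TrivializedBy c F univ := by
  let _ : TopologicalSpace G := ⊥
  have _ : DiscreteTopology G := ⟨rfl⟩
  have h : ∀ x : X, ∃ φ : X → G, ∃ U : Set X, IsOpen U ∧ x ∈ U ∧
      ∀ y ∈ U, ∀ z ∈ U, c y z = (φ y)⁻¹ * φ z := fun x => by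
    obtain ⟨φ, hφ⟩ := hc x (mem_univ x)
    rw [nhds_prod_eq] at hφ
    obtain ⟨U, hU, h⟩ := mem_prod_self_iff.1 hφ
    obtain ⟨V, hVU, hV, hx⟩ := mem_nhds_iff.1 hU
    exact ⟨φ, V, hV, hx, fun y hy z hz =>
      h (show (y, z) ∈ U ×ˢ U from ⟨hVU hy, hVU hz⟩)⟩
  choose φ U hU hxU hφ using h
  let Z : FiberBundleCore X X G :=
    -- A germ of trivialization at `x` has the form `v * φ i`, and `v` is its coordinate in the
    -- chart `i`. The chart change equates `v * φ i x` with the corresponding product for `j`; it is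
    -- locally constant in `x`, so the bundle with discrete fibre is a covering.
    { baseSet := U
      isOpen_baseSet := hU
      indexAt := id
      mem_baseSet_at := hxU
      coordChange := fun i j x v => v * φ i x * (φ j x)⁻¹
      coordChange_self := fun i x _ v => by simp
      continuousOn_coordChange := fun i j => by
        rintro ⟨x, v⟩ ⟨⟨hi, hj⟩, -⟩
        apply ContinuousAt.continuousWithinAt
        unfold ContinuousAt
        rw [nhds_discrete G]
        refine tendsto_pure.2 ?_
        rw [nhds_prod_eq, nhds_discrete G, prod_pure, eventually_map]
        filter_upwards [(hU i).mem_nhds hi, (hU j).mem_nhds hj] with y hyi hyj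
        have e1 := hφ i x hi y hyi
        have e2 := hφ j x hj y hyj
        rw [e2] at e1
        have : φ j y = φ j x * (φ i x)⁻¹ * φ i y := by
          rw [mul_assoc, ← e1]; group
        simp only [this]
        group
      coordChange_comp := fun i j k x _ v => by group }
  have cov : IsCoveringMap Z.proj := FiberBundle.isCoveringMap (F := G) (E := Z.Fiber)
  obtain ⟨x₀⟩ : Nonempty X := inferInstance
  obtain ⟨s, ⟨-, hs⟩, -⟩ := cov.existsUnique_continuousMap_lifts (ContinuousMap.id X) x₀
    (⟨x₀, (1 : G)⟩ : Z.TotalSpace) rfl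
  have hs' : ∀ x, (s x).1 = x := fun x => congrFun hs x
  let v : X → G := fun x => (s x).2
  -- The value at `x` of the germ `s x`, read in the chart indexed by `x` itself.
  refine ⟨fun x => v x * φ x x, fun x _ => ?_⟩
  have hloc : ∀ y, (Z.localTriv x (s y)).2 = v y * φ y y * (φ x y)⁻¹ := fun y => by
    rw [FiberBundleCore.localTriv_apply]
    simp only [Z, v, hs', id]
  have hcont : ContinuousAt (fun y => (Z.localTriv x (s y)).2) x := by
    refine continuousAt_snd.comp (ContinuousAt.comp (f := s) ?_ s.continuous.continuousAt)
    refine (Z.localTriv x).continuousAt ?_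
    rw [(Z.localTriv x).mem_source]
    show (s x).1 ∈ U x
    rw [hs']
    exact hxU x
  unfold ContinuousAt at hcont
  rw [nhds_discrete G, tendsto_pure] at hcont
  simp only [hloc] at hcont
  filter_upwards [eventually_diag_mem (hcont.and ((hU x).mem_nhds (hxU x)))]
  rintro ⟨y, z⟩ ⟨⟨hy, hyU⟩, ⟨hz, hzU⟩⟩
  simp only at hy hz hyU hzU ⊢
  rw [hφ x y hyU z hzU]
  rw [mul_inv_eq_iff_eq_mul] at hy hz
  rw [hy, hz]
  group

/-- Cocycles on two open sets that agree near the diagonal of the intersection can be glued. -/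
theorem exists_glue [NormalSpace X] {U V : Set X} (hU : IsOpen U) (hV : IsOpen V)
    (hUV : U ∪ V = univ) {c₁ c₂ : X → X → G} (h₁ : IsCocycleOn c₁ U) (h₂ : IsCocycleOn c₂ V)
    (h : ∀ x ∈ U ∩ V, ∀ᶠ p in 𝓝 (x, x), c₁ p.1 p.2 = c₂ p.1 p.2) :
    ∃ c : X → X → G, IsCocycleOn c univ ∧
      (∀ x ∈ U, ∀ᶠ p in 𝓝 (x, x), c p.1 p.2 = c₁ p.1 p.2) ∧
      ∀ x ∈ V, ∀ᶠ p in 𝓝 (x, x), c p.1 p.2 = c₂ p.1 p.2 := by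
  classical
  have hVU : Vᶜ ⊆ U := fun x hx => (hUV.ge (mem_univ x)).resolve_right hx
  obtain ⟨W, hW, hVW, hWU⟩ := normal_exists_closure_subset hV.isClosed_compl hU hVU
  have hWV : Wᶜ ⊆ V := fun x hx => by_contra fun hxV => hx (hVW hxV)
  -- Cocycles need not be continuous, so a cut-off suffices: at the frontier of `W` both cocycles
  -- are defined and agree, and either branch gives the same value.
  let c : X → X → G := fun x y => if x ∈ W ∧ y ∈ W then c₁ x y else c₂ x y
  have hc₁ : ∀ x ∈ U, ∀ᶠ p in 𝓝 (x, x), c p.1 p.2 = c₁ p.1 p.2 := fun x hx => by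
    by_cases hxW : x ∈ W
    · filter_upwards [eventually_diag_mem (hW.mem_nhds hxW)] with p hp
      exact if_pos hp
    · filter_upwards [h x ⟨hx, hWV hxW⟩] with p hp
      by_cases hpW : p.1 ∈ W ∧ p.2 ∈ W
      · exact if_pos hpW
      · rw [hp]; exact if_neg hpW
  have hc₂ : ∀ x ∈ V, ∀ᶠ p in 𝓝 (x, x), c p.1 p.2 = c₂ p.1 p.2 := fun x hx => by
    by_cases hxW : x ∈ closure W
    · filter_upwards [h x ⟨hWU hxW, hx⟩] with p hp
      by_cases hpW : p.1 ∈ W ∧ p.2 ∈ W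
      · rw [← hp]; exact if_pos hpW
      · exact if_neg hpW
    · filter_upwards [eventually_diag_mem (isClosed_closure.isOpen_compl.mem_nhds hxW)] with p hp
      exact if_neg fun hpW => hp.1 (subset_closure hpW.1)
  refine ⟨c, fun x _ => ?_, hc₁, hc₂⟩
  rcases hUV.ge (mem_univ x) with hx | hx
  · exact h₁.congr hc₁ x hx
  · exact h₂.congr hc₂ x hx

/-- A function that trivializes the pullback of a cocycle to a connected space is multiplied by a
constant under covering transformations. -/
theorem TrivializedBy.deck [PreconnectedSpace Y] {Z : Type*} {c : Z → Z → G} {π : Y → Z} {F : Y → G}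
    (hF : TrivializedBy (fun y z => c (π y) (π z)) F univ) {τ : Y → Y} (hτ : Continuous τ)
    (hπτ : ∀ y, π (τ y) = π y) (y z : Y) : F (τ y) * (F y)⁻¹ = F (τ z) * (F z)⁻¹ := by
  refine eq_of_eventually_eq isPreconnected_univ (f := fun y => F (τ y) * (F y)⁻¹)
    (fun x _ => ?_) (mem_univ y) (mem_univ z)
  filter_upwards [eventually_of_diag (hF x (mem_univ x)),
    eventually_of_diag (eventually_diag_comp hτ.continuousAt (hF (τ x) (mem_univ _)))] with w h1 h2
  simp only [hπτ] at h1 h2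
  rw [h1] at h2
  have : F (τ w) = F (τ x) * ((F x)⁻¹ * F w) := by rw [h2]; group
  rw [this]
  group

/-- Where `k` reduces a cocycle trivialized by `F`, the product `F * k` is locally constant
modulo `A`. -/
theorem ReducedOn.inv_mul_mem {c : X → X → G} {π : Y → X} {F : Y → G}
    (hF : TrivializedBy (fun y z => c (π y) (π z)) F univ) (hπ : Continuous π) {S : Set X}
    {k : X → G} {A : Subgroup G} (hk : ReducedOn c k A S) {T : Set Y} (hT : IsPreconnected T)
    (hTS : ∀ y ∈ T, π y ∈ S) {y z : Y} (hy : y ∈ T) (hz : z ∈ T) :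
    (F y * k (π y))⁻¹ * (F z * k (π z)) ∈ A := by
  rw [← QuotientGroup.eq]
  refine eq_of_eventually_eq hT (f := fun y => ((F y * k (π y) : G) : G ⧸ A)) (fun x hx => ?_) hy hz
  filter_upwards [eventually_of_diag (hF x (mem_univ x)),
    eventually_of_diag (eventually_diag_comp hπ.continuousAt (hk (π x) (hTS x hx)))] with w h1 h2
  symm
  rw [QuotientGroup.eq]
  simp only [gauge] at h1 h2
  rw [h1] at h2
  convert h2 using 1
  group

/-- A reduction outside a closed set `Z` covered by a suitable patch extends across `Z`. -/
theorem ReducedOn.exists_extend [PreconnectedSpace Y] {c : X → X → G} {π : Y → X} {F : Y → G}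
    (hF : TrivializedBy (fun y z => c (π y) (π z)) F univ) (hπ : Continuous π)
    (hπo : IsOpenMap π)
    (deck : ∀ y z, π y = π z → ∃ τ : Y → Y, Continuous τ ∧ (∀ w, π (τ w) = π w) ∧ τ y = z)
    {Z : Set X} (hZ : IsClosed Z) (hZπ : Z ⊆ range π) (hZc : IsConnected (π ⁻¹' Zᶜ))
    {k : X → G} {A : Subgroup G} (hk : ReducedOn c k A Zᶜ) :
    ∃ k' : X → G, ReducedOn c k' A univ := by
  classical
  obtain ⟨y₀, hy₀⟩ := hZc.nonempty
  choose s hs using hZπ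
  let m := F y₀ * k (π y₀)
  -- Chosen so that `F * k'` equals `m` at the selected lift of each point of `Z`. Another lift
  -- differs by a deck transformation `τ`, whose factor lies in `m * A * m⁻¹`, as is seen by
  -- comparing `y₀` with `τ y₀` outside `Z`.
  let k' : X → G := fun x => if hx : x ∈ Z then (F (s hx))⁻¹ * m else k x
  have hk' : ∀ x, x ∉ Z → k' x = k x := fun x hx => dif_neg hx
  have key : ∀ y, m⁻¹ * (F y * k' (π y)) ∈ A := fun y => by
    by_cases hy : π y ∈ Z
    · obtain ⟨τ, hτ, hπτ, hτy⟩ := deck (s hy) y (hs hy)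
      have h1 := hF.deck hτ hπτ (s hy) y₀
      have h2 := hk.inv_mul_mem hF hπ hZc.isPreconnected (fun _ h => h) hy₀
        (show τ y₀ ∈ π ⁻¹' Zᶜ by rw [mem_preimage, hπτ]; exact hy₀)
      rw [hτy] at h1
      rw [hπτ] at h2
      have h3 : k' (π y) = (F (s hy))⁻¹ * m := dif_pos hy
      rw [h3, ← mul_assoc (F y), h1]
      convert h2 using 1
      simp only [m]
      group
    · rw [hk' _ hy]
      exact hk.inv_mul_mem hF hπ hZc.isPreconnected (fun _ h => h) hy₀ hy
  refine ⟨k', fun x _ => ?_⟩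
  by_cases hx : x ∈ Z
  · rw [← hs hx]
    refine eventually_diag_of_isOpenMap hπo ?_
    filter_upwards [hF (s hx) (mem_univ _)] with p hp
    simp only [gauge, hp]
    convert A.mul_mem (A.inv_mem (key p.1)) (key p.2) using 1
    group
  · filter_upwards [hk x hx, eventually_diag_mem (hZ.isOpen_compl.mem_nhds hx)] with p h1 h2
    simpa only [gauge, hk' _ h2.1, hk' _ h2.2] using h1

/-! ### Local systems on tori -/

/-- The quotient of a simply connected abelian group by a lattice has only commutative local
systems. -/
theorem not_hasNonabelianCocycle_of_lattice {V : Type*} [AddCommGroup V] [TopologicalSpace V]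
    [ContinuousAdd V] [SimplyConnectedSpace V] [LocallyPathConnectedSpace V] {π : V → X}
    (hπ : Continuous π) (hπo : IsOpenMap π) (hπs : Function.Surjective π)
    (h : ∀ v w, π v = π w → ∀ x, π (x + (w - v)) = π x) : ¬ HasNonabelianCocycle X G := by
  rintro ⟨c, hc, hirr⟩
  obtain ⟨F, hF⟩ := (hc.comp (g := π) (T := univ) (fun y _ => hπ.continuousAt)
    (fun _ _ => mem_univ _)).trivializedBy
  let ρ : V → G := fun n => F n * (F 0)⁻¹
  have hρ : ∀ n, (∀ x, π (x + n) = π x) → ∀ x, F (x + n) = ρ n * F x := fun n hn x => by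
    have := hF.deck (τ := fun x => x + n) (by fun_prop) hn x 0
    rw [zero_add] at this
    rw [← mul_inv_eq_iff_eq_mul, this]
  have hmul : ∀ n m, (∀ x, π (x + n) = π x) → (∀ x, π (x + m) = π x) → ρ (n + m) = ρ n * ρ m :=
    fun n m hn hm => by
      have h1 := hρ n hn m
      simp only [ρ] at h1 ⊢
      rw [add_comm n m, h1]
      group
  have hneg : ∀ n, (∀ x, π (x + n) = π x) → ∀ x, π (x + -n) = π x := fun n hn x => by
    rw [← hn (x + -n)]; congr 1; abel
  -- The image of the holonomy `ρ` on the group of periods; it is commutative because addition in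
  -- `V` is.
  let A : Subgroup G :=
    { carrier := {g | ∃ n, (∀ x, π (x + n) = π x) ∧ ρ n = g}
      mul_mem' := by
        rintro _ _ ⟨n, hn, rfl⟩ ⟨m, hm, rfl⟩
        exact ⟨n + m, fun x => by rw [← add_assoc, hm, hn], hmul n m hn hm⟩
      one_mem' := ⟨0, by simp, by simp [ρ]⟩
      inv_mem' := by
        rintro _ ⟨n, hn, rfl⟩
        refine ⟨-n, hneg n hn, ?_⟩
        have := hmul (-n) n (hneg n hn) hn
        rw [eq_inv_iff_mul_eq_one, ← this]
        simp [ρ] }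
  choose s hs using hπs
  have hA : ∀ v, F v * (F (s (π v)))⁻¹ ∈ A := fun v => by
    have hn := h _ _ (hs (π v))
    refine ⟨v - s (π v), hn, ?_⟩
    have := hρ _ hn (s (π v))
    rw [add_sub_cancel] at this
    rw [this]
    group
  refine hirr (fun x => (F (s x))⁻¹) A ?_ fun x _ => ?_
  · rintro _ ⟨n, hn, rfl⟩ _ ⟨m, hm, rfl⟩
    rw [← hmul n m hn hm, add_comm, hmul m n hm hn]
  · rw [← hs x]
    refine eventually_diag_of_isOpenMap hπo ?_
    filter_upwards [hF (s x) (mem_univ _)] with p hp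
    simp only [gauge, hp]
    convert A.mul_mem (A.inv_mem (hA p.1)) (hA p.2) using 1
    group

/-! ### Cocycles on products with a circle, and invariance under surgery -/

theorem apply_add_int_mul {f : ℝ → G} {T : ℝ} {γ : G} (hf : ∀ t, f (t + T) = γ * f t) (t : ℝ)
    (n : ℤ) : f (t + n * T) = γ ^ n * f t := by
  induction n with
  | zero => simp
  | succ n ih =>
    rw [show t + ((n + 1 : ℤ) : ℝ) * T = t + ((n : ℤ) : ℝ) * T + T by push_cast; ring, hf, ih,
      ← mul_assoc, add_comm, zpow_add, zpow_one]
  | pred n ih =>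
    have h := hf (t + ((-n - 1 : ℤ) : ℝ) * T)
    rw [show t + ((-n - 1 : ℤ) : ℝ) * T + T = t + ((-n : ℤ) : ℝ) * T by push_cast; ring, ih] at h
    rw [sub_eq_neg_add, zpow_add, zpow_neg_one, mul_assoc, h]
    rw [← sub_eq_neg_add]
    group

theorem isOpenMap_circleExp : IsOpenMap Circle.exp := isLocalHomeomorph_circleExp.isOpenMap

theorem continuousAt_circleArg : ContinuousAt (fun u : Circle => Complex.arg u) 1 := by
  have : ContinuousAt Complex.arg ((1 : Circle) : ℂ) := Complex.continuousAt_arg (by simp)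
  exact ContinuousAt.comp (f := fun u : Circle => (u : ℂ)) this (by fun_prop)

/-- An equivariant function on `B × ℝ` defines a cocycle on `B × S¹`. -/
theorem exists_cocycle_prod_circle {F : B × ℝ → G} {γ : G}
    (hF : ∀ b t, F (b, t + 2 * Real.pi) = γ * F (b, t)) :
    ∃ c : B × Circle → B × Circle → G, IsCocycleOn c univ ∧
      TrivializedBy (fun x y : B × ℝ => c (x.1, Circle.exp x.2) (y.1, Circle.exp y.2)) F univ := by
  -- Lift the first point by `arg`, then move by the short arc to the second. Another lift of the
  -- first point multiplies both factors by the same power of `γ`, which cancels.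
  let c : B × Circle → B × Circle → G := fun x y =>
    (F (x.1, Complex.arg x.2))⁻¹ * F (y.1, Complex.arg x.2 + Complex.arg (y.2 / x.2 : Circle))
  have hc : TrivializedBy (fun x y : B × ℝ => c (x.1, Circle.exp x.2) (y.1, Circle.exp y.2)) F
      univ := by
    rintro ⟨b, t⟩ -
    have hcont : ContinuousAt (fun p : (B × ℝ) × (B × ℝ) => p.2.2 - p.1.2) ((b, t), (b, t)) := by
      fun_prop
    have h0 : Ioo (-Real.pi) Real.pi ∈ 𝓝 ((fun p : (B × ℝ) × (B × ℝ) => p.2.2 - p.1.2)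
        ((b, t), (b, t))) := by
      simpa using Ioo_mem_nhds (neg_lt_zero.2 Real.pi_pos) Real.pi_pos
    filter_upwards [hcont.preimage_mem_nhds h0]
    rintro ⟨⟨b₁, t₁⟩, b₂, t₂⟩ h
    simp only [mem_preimage, mem_Ioo] at h
    simp only [c]
    obtain ⟨n, hn⟩ := Circle.exp_eq_exp.1 (Circle.exp_arg (Circle.exp t₁))
    rw [← Circle.exp_sub, Circle.arg_exp h.1 h.2.le, hn,
      show t₁ + n * (2 * Real.pi) + (t₂ - t₁) = t₂ + n * (2 * Real.pi) by ring,
      apply_add_int_mul (f := fun t => F (b₁, t)) (hF b₁),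
      apply_add_int_mul (f := fun t => F (b₂, t)) (hF b₂)]
    group
  refine ⟨c, ?_, hc⟩
  rintro ⟨b, u⟩ -
  let σ : B × Circle → B × ℝ := fun y => (y.1, Complex.arg u + Complex.arg (y.2 / u : Circle))
  have hσ : ∀ y, ((σ y).1, Circle.exp (σ y).2) = y := fun y =>
    Prod.ext rfl (by
      simp only [σ]
      rw [Circle.exp_add, Circle.exp_arg, Circle.exp_arg, mul_div_cancel])
  have hσc : ContinuousAt σ (b, u) := by
    refine continuousAt_fst.prodMk (continuousAt_const.add ?_)
    refine ContinuousAt.comp (f := fun y : B × Circle => y.2 / u)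
      (g := fun v : Circle => Complex.arg v) ?_ (by fun_prop)
    simpa using continuousAt_circleArg
  refine ⟨F ∘ σ, ?_⟩
  have := eventually_diag_comp hσc (hc (σ (b, u)) (mem_univ _))
  simpa only [hσ, Function.comp_apply] using this

theorem norm_mul_circleExp_arg (z : ℂ) : (‖z‖ : ℂ) * (Circle.exp z.arg : ℂ) = z := by
  rw [Circle.coe_exp, Complex.norm_mul_exp_arg_mul_I]

/-- Nonabelian local systems survive surgeries that do not change the triviality of the holonomy
along the meridian. -/
theorem HasNonabelianCocycle.of_surgery [NormalSpace Y] {f : ℂ × Circle → X}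
    {f' : ℂ × Circle → Y} (hf : IsOpenEmbedding f) (hf' : IsOpenEmbedding f')
    (h : OpenPartialHomeomorph X Y) (hs : h.source = (f '' ({0} ×ˢ univ))ᶜ)
    (ht : h.target = (f' '' ({0} ×ˢ univ))ᶜ) {q p b e : ℤ} (hp : ∀ g : G, g ^ p = 1)
    (hrel : ∀ (r : ℝ) (u v : Circle), 0 < r →
      h (f ((r : ℂ) * ((u ^ q * v ^ b : Circle) : ℂ), u ^ p * v ^ e)) = f' ((r : ℂ) * (u : ℂ), v))
    (hX : HasNonabelianCocycle X G) : HasNonabelianCocycle Y G := by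
  obtain ⟨c, hc, hirr⟩ := hX
  let π : ℂ × ℝ → ℂ × Circle := fun y => (y.1, Circle.exp y.2)
  have hπ : Continuous π := by fun_prop
  have hπo : IsOpenMap π := IsOpenMap.id.prodMap isOpenMap_circleExp
  have hfπ : Continuous (f ∘ π) := hf.continuous.comp hπ
  obtain ⟨F, hF⟩ := (hc.comp (g := f ∘ π) (T := univ) (fun y _ => hfπ.continuousAt)
    (fun _ _ => mem_univ _)).trivializedBy
  have hτ : ∀ (n : ℤ) (w : ℂ × ℝ), (f ∘ π) (w.1, w.2 + n * (2 * Real.pi)) = (f ∘ π) w :=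
    fun n w => by
      simp only [Function.comp_apply, π]
      rw [Circle.exp_add, Circle.exp_int_mul_two_pi, mul_one]
  -- The holonomy along the core, computed on the universal cover `ℂ × ℝ` of the solid torus.
  let γ : G := F (0, 0 + (1 : ℤ) * (2 * Real.pi)) * (F (0, 0))⁻¹
  have hγ : ∀ (n : ℤ) (z : ℂ) (t : ℝ), F (z, t + n * (2 * Real.pi)) = γ ^ n * F (z, t) :=
    fun n z t => by
      refine apply_add_int_mul (f := fun t => F (z, t)) (fun t => ?_) t n
      have := hF.deck (τ := fun w => (w.1, w.2 + (1 : ℤ) * (2 * Real.pi))) (by fun_prop) (hτ 1)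
        (z, t) (0, 0)
      rw [← mul_inv_eq_iff_eq_mul]
      simpa only [γ, Int.cast_one, one_mul] using this
  -- The gluing map lifted to the covers, with `θ` a choice of argument of `y.1`.
  let Ψ : ℝ → ℂ × ℝ → ℂ × ℝ := fun θ y =>
    ((‖y.1‖ : ℂ) * (Circle.exp (q * θ + b * y.2) : ℂ), p * θ + e * y.2)
  -- One turn along the new meridian contributes `γ ^ p = 1`; the turns about the old meridian are
  -- invisible in `ℂ × ℝ`. This is where the exponent of `G` enters.
  have hΨ : ∀ (n : ℤ) θ y, F (Ψ (θ + n * (2 * Real.pi)) y) = F (Ψ θ y) := fun n θ y => by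
    simp only [Ψ]
    rw [show (q : ℝ) * (θ + n * (2 * Real.pi)) + b * y.2 =
        q * θ + b * y.2 + ((q * n : ℤ) : ℝ) * (2 * Real.pi) by push_cast; ring,
      Circle.exp_add, Circle.exp_int_mul_two_pi, mul_one,
      show (p : ℝ) * (θ + n * (2 * Real.pi)) + e * y.2 =
        p * θ + e * y.2 + ((p * n : ℤ) : ℝ) * (2 * Real.pi) by push_cast; ring,
      hγ, zpow_mul, hp, one_zpow, one_mul]
  -- By `hΨ` the jump of `arg` does no harm. On the core the default `arg 0 = 0` is equally
  -- harmless, since only equivariance in the second variable is required of `F'`.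
  let F' : ℂ × ℝ → G := fun y => F (Ψ y.1.arg y)
  have hF'γ : ∀ z t, F' (z, t + 2 * Real.pi) = γ ^ e * F' (z, t) := fun z t => by
    simp only [F', Ψ]
    rw [show (q : ℝ) * z.arg + b * (t + 2 * Real.pi) =
        q * z.arg + b * t + (b : ℝ) * (2 * Real.pi) by ring,
      Circle.exp_add, Circle.exp_int_mul_two_pi, mul_one,
      show (p : ℝ) * z.arg + e * (t + 2 * Real.pi) =
        p * z.arg + e * t + (e : ℝ) * (2 * Real.pi) by ring, hγ]
  have hsymm : ∀ (θ : ℝ) (y : ℂ × ℝ), y.1 ≠ 0 → (‖y.1‖ : ℂ) * (Circle.exp θ : ℂ) = y.1 →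
      h.symm (f' (π y)) = f (π (Ψ θ y)) := fun θ y hy hθ => by
    have h1 := hrel ‖y.1‖ (Circle.exp θ) (Circle.exp y.2) (norm_pos_iff.2 hy)
    simp only [← Circle.exp_intCast_mul, ← Circle.exp_add] at h1
    rw [hθ] at h1
    rw [show f' (π y) = f' (y.1, Circle.exp y.2) from rfl, ← h1]
    refine h.left_inv ?_
    rw [hs]
    rintro ⟨w, hw, hfw⟩
    have h2 := congrArg Prod.fst (hf.injective hfw)
    rw [show w.1 = 0 from hw.1] at h2
    exact mul_ne_zero (by simpa using hy) (Circle.coe_ne_zero _) h2.symm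
  obtain ⟨c₀, hc₀, hc₀F⟩ := exists_cocycle_prod_circle hF'γ
  have : Nonempty (ℂ × Circle) := ⟨(0, 1)⟩
  let j := hf'.toOpenPartialHomeomorph f'
  have hj : ∀ y, j.symm (f' y) = y := fun y => hf'.toOpenPartialHomeomorph_left_inv
  have hc₁ : IsCocycleOn (fun x y => c (h.symm x) (h.symm y)) h.target :=
    hc.comp (fun y hy => h.continuousAt_symm hy) (fun _ _ => mem_univ _)
  have hc₂ : IsCocycleOn (fun x y => c₀ (j.symm x) (j.symm y)) (range f') :=
    hc₀.comp (fun y hy => j.continuousAt_symm (by simpa [j] using hy)) (fun _ _ => mem_univ _)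
  obtain ⟨c', hc', hcc₁, -⟩ := exists_glue h.open_target hf'.isOpen_range (by
      rw [ht, eq_univ_iff_forall]
      intro x
      by_cases hx : x ∈ range f'
      · exact Or.inr hx
      · exact Or.inl fun hx' => hx (image_subset_range _ _ hx')) hc₁ hc₂ (by
    rintro _ ⟨hx, ⟨⟨z, v⟩, rfl⟩⟩
    obtain ⟨t, rfl⟩ := Circle.exp_surjective v
    have hz : z ≠ 0 := by
      rintro rfl
      rw [ht] at hx
      exact hx ⟨(0, _), ⟨rfl, mem_univ _⟩, rfl⟩
    change ∀ᶠ p in 𝓝 ((f' ∘ π) (z, t), (f' ∘ π) (z, t)), _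
    refine eventually_diag_of_isOpenMap (hf'.isOpenMap.comp hπo) ?_
    -- A branch of the argument continuous at `z`, even where `arg` jumps.
    let θ : ℂ → ℝ := fun w => z.arg + (w / z).arg
    have hθ : ∀ w, w ≠ 0 → Circle.exp (θ w) = Circle.exp w.arg := fun w hw => by
      rw [Circle.exp_eq_exp]
      have : ((w / z * z).arg : Real.Angle) = ((w / z).arg + z.arg : ℝ) := by
        rw [Complex.arg_mul_coe_angle (div_ne_zero hw hz) hz, Real.Angle.coe_add]
      rw [div_mul_cancel₀ _ hz, eq_comm, Real.Angle.angle_eq_iff_two_pi_dvd_sub] at this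
      obtain ⟨n, hn⟩ := this
      exact ⟨n, by simp only [θ]; linarith⟩
    have hθc : ContinuousAt θ z := by
      refine continuousAt_const.add (ContinuousAt.comp (f := fun w => w / z) (g := Complex.arg) ?_
        (by fun_prop (disch := exact hz)))
      exact Complex.continuousAt_arg (by simp [div_self hz])
    have hy : ContinuousAt (fun y : ℂ × ℝ => Ψ (θ y.1) y) (z, t) := by
      have h1 : ContinuousAt (fun y : ℂ × ℝ => θ y.1) (z, t) :=
        ContinuousAt.comp (f := Prod.fst) (g := θ) (x := (z, t)) hθc continuousAt_fst
      simp only [Ψ]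
      fun_prop
    have hne : {y : ℂ × ℝ | y.1 ≠ 0} ∈ 𝓝 (z, t) :=
      (isOpen_ne.preimage continuous_fst).mem_nhds hz
    filter_upwards [eventually_diag_comp hy (hF _ (mem_univ _)),
      hc₀F (z, t) (mem_univ _), eventually_diag_mem hne]
    rintro ⟨y₁, y₂⟩ e1 e2 ⟨hn₁, hn₂⟩
    have hF' : ∀ y : ℂ × ℝ, y.1 ≠ 0 → F (Ψ (θ y.1) y) = F' y := fun y hyn => by
      obtain ⟨n, hn⟩ := Circle.exp_eq_exp.1 (hθ y.1 hyn)
      rw [hn, hΨ]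
    have hs' : ∀ y : ℂ × ℝ, y.1 ≠ 0 → h.symm (f' (π y)) = f (π (Ψ (θ y.1) y)) := fun y hyn =>
      hsymm _ y hyn (by rw [hθ _ hyn, norm_mul_circleExp_arg])
    simp only [Function.comp_apply] at e1 e2 ⊢
    rw [hs' _ hn₁, hs' _ hn₂, hj, hj, e1, hF' _ hn₁, hF' _ hn₂]
    exact e2.symm)
  refine ⟨c', hc', fun k A hA hk => ?_⟩
  have hk' : ReducedOn c (k ∘ h) A (f '' ({0} ×ˢ univ))ᶜ := hs ▸ hk.of_openPartialHomeomorph hcc₁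
  have hpre : f ∘ π ⁻¹' (f '' ({0} ×ˢ univ))ᶜ = {0}ᶜ ×ˢ univ := by
    ext ⟨z, t⟩
    simp only [mem_preimage, Function.comp_apply, mem_compl_iff, hf.injective.mem_set_image, π]
    simp
  -- A commutative reduction on `Y` restricts to the complement of the old core. It extends over
  -- that core because `ℂ × ℝ` minus the axis is connected.
  obtain ⟨k', hk''⟩ := hk'.exists_extend hF hfπ (hf.isOpenMap.comp hπo) (fun y z hyz => by
      have hyz' := hf.injective hyz
      obtain ⟨n, hn⟩ := Circle.exp_eq_exp.1 (congrArg Prod.snd hyz').symm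
      exact ⟨fun w => (w.1, w.2 + n * (2 * Real.pi)), by fun_prop, hτ n,
        Prod.ext (congrArg Prod.fst hyz' :) hn.symm⟩)
    (by rw [← isOpen_compl_iff, ← hs]; exact h.open_source)
    (by
      rintro _ ⟨⟨z, v⟩, -, rfl⟩
      obtain ⟨t, rfl⟩ := Circle.exp_surjective v
      exact ⟨(z, t), rfl⟩)
    (by
      rw [hpre]
      exact (isConnected_compl_singleton_of_one_lt_rank (by simp) 0).prod isConnected_univ)
  exact hirr k' A hA hk''

theorem HasNonabelianCocycle.of_homeomorph (e : X ≃ₜ Y) (hX : HasNonabelianCocycle X G) :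
    HasNonabelianCocycle Y G := by
  obtain ⟨c, hc, hirr⟩ := hX
  refine ⟨fun x y => c (e.symm x) (e.symm y), hc.comp (fun _ _ => e.symm.continuous.continuousAt)
    (fun _ _ => mem_univ _), fun k A hA hk => hirr (k ∘ e) A hA ?_⟩
  have := hk.comp (g := e) (T := univ) (fun _ _ => e.continuous.continuousAt)
    (fun _ _ => mem_univ _)
  simpa only [e.symm_apply_apply] using this

/-! ### Gauge fixing on an open piece, and prescribed holonomy -/

/-- A cocycle can be made trivial on a simply connected open set by a gauge transformation that is
trivial at a given point. -/
theorem IsCocycleOn.exists_gauge [SimplyConnectedSpace Y] [LocallyPathConnectedSpace Y]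
    {c : X → X → G} (hc : IsCocycleOn c univ) {f : Y → X} (hf : IsOpenEmbedding f) (v : Y) :
    ∃ κ : X → G, κ (f v) = 1 ∧
      ∀ x ∈ range f, ∀ᶠ p in 𝓝 (x, x), LocalSystem.gauge c κ p.1 p.2 = 1 := by
  obtain ⟨F, hF⟩ := (hc.comp (g := f) (T := univ) (fun y _ => hf.continuous.continuousAt)
    (fun _ _ => mem_univ _)).trivializedBy
  have : Nonempty Y := ⟨v⟩
  have hinv := Function.leftInverse_invFun hf.injective
  refine ⟨fun x => (F (Function.invFun f x))⁻¹ * F v, by simp [hinv v], ?_⟩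
  rintro _ ⟨y, rfl⟩
  refine eventually_diag_of_isOpenMap hf.isOpenMap ?_
  filter_upwards [hF y (mem_univ y)] with p hp
  simp only [LocalSystem.gauge, hinv _, hp]
  group

theorem trivializedBy_one_of_eventually {c : X → X → G} {f : Y → X} (hf : Continuous f)
    (hc : ∀ x ∈ range f, ∀ᶠ p in 𝓝 (x, x), c p.1 p.2 = 1) :
    TrivializedBy (fun y z => c (f y) (f z)) (fun _ => 1) univ := fun y _ => by
  simpa using eventually_diag_comp hf.continuousAt (hc _ ⟨y, rfl⟩)

/-- On the product of the circle with a space there is a cocycle with prescribed holonomy along the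
circle, which moreover is trivial on a given simply connected open set. -/
theorem exists_cocycle_circle_prod [SimplyConnectedSpace Y] [LocallyPathConnectedSpace Y]
    {S : Type*} [TopologicalSpace S] (Φ : X ≃ₜ Circle × S) {f : Y → X} (hf : IsOpenEmbedding f)
    {v w : Y} (hvw : (Φ (f v)).2 ≠ (Φ (f w)).2) (g : G) :
    ∃ c : X → X → G, IsCocycleOn c univ ∧
      (∀ x ∈ range f, ∀ᶠ p in 𝓝 (x, x), c p.1 p.2 = 1) ∧
      ∀ (k : X → G) (A : Subgroup G), ReducedOn c k A {f w}ᶜ →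
        (k (f v))⁻¹ * g * k (f v) ∈ A := by
  -- A step function with jump `g` per period; no continuity is needed.
  let F : S × ℝ → G := fun y => g ^ ⌊y.2 / (2 * Real.pi)⌋
  have hF : ∀ s t, F (s, t + 2 * Real.pi) = g * F (s, t) := fun s t => by
    simp only [F]
    rw [add_div, div_self (by positivity), Int.floor_add_one, add_comm, zpow_add, zpow_one]
  obtain ⟨c₀, hc₀, hc₀F⟩ := exists_cocycle_prod_circle hF
  have hcσ : IsCocycleOn (fun x y => c₀ (Φ x).swap (Φ y).swap) univ :=
    hc₀.comp (fun x _ => by fun_prop) (fun _ _ => mem_univ _)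
  obtain ⟨κ, hκ, hκf⟩ := hcσ.exists_gauge hf v
  refine ⟨_, hcσ.gauge κ, hκf, fun k A hk => ?_⟩
  rw [reducedOn_gauge] at hk
  let t : ℝ := Complex.arg (Φ (f v)).1
  let l : ℝ → X := fun t => Φ.symm (Circle.exp t, (Φ (f v)).2)
  have hl : Continuous l := by fun_prop
  have ht : l t = f v := by simp [l, t, Circle.exp_arg]
  have ht' : l (t + 2 * Real.pi) = f v := by
    rw [← ht]; simp only [l, Circle.exp_add_two_pi]
  have hlF : TrivializedBy (fun x y => c₀ (Φ (l x)).swap (Φ (l y)).swap)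
      (fun t => F ((Φ (f v)).2, t)) univ := fun x _ => by
    have := eventually_diag_comp (g := fun t : ℝ => ((Φ (f v)).2, t)) (y := x) (by fun_prop)
      (hc₀F _ (mem_univ _))
    simpa only [l, Homeomorph.apply_symm_apply, Prod.swap_prod_mk] using this
  -- The circle through `f v` avoids `f w` because their second coordinates differ, so the reduction
  -- is available along the whole loop.
  have key := hk.inv_mul_mem (π := l) hlF hl isPreconnected_univ (fun y _ hy => hvw (by
    rw [← (show l y = f w from hy)]; simp [l])) (mem_univ t) (mem_univ (t + 2 * Real.pi))
  rw [hF, ht, ht', hκ, one_mul] at key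
  have hcomm : g * F ((Φ (f v)).2, t) = F ((Φ (f v)).2, t) * g := (Commute.self_zpow g _).eq
  rw [hcomm] at key
  convert key using 1
  group

end LocalSystem

/-! ### Connected sums, the torus and Dehn surgery -/

open LocalSystem

namespace ClosedOriented3Manifold

variable {G : Type*} [Group G] {M M' M₁ M₂ P : ClosedOriented3Manifold}

theorem IsBallEmbedding.isOpenEmbedding {f : E3 → M} (hf : IsBallEmbedding f) :
    IsOpenEmbedding f :=
  .of_continuous_injective_isOpenMap hf.2.isLocalHomeomorph.continuous hf.1 hf.2.isOpenMap

theorem IsSolidTorusEmbedding.isOpenEmbedding {f : ℂ × Circle → M}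
    (hf : IsSolidTorusEmbedding f) : IsOpenEmbedding f :=
  .of_continuous_injective_isOpenMap hf.2.isLocalHomeomorph.continuous hf.1 hf.2.isOpenMap

/-- Cocycles on the summands that are trivial on the balls define a cocycle on the connected
sum. -/
theorem exists_cocycle_connectedSum {f₁ : E3 → M₁} {f₂ : E3 → M₂}
    (hf₁ : IsOpenEmbedding f₁) (hf₂ : IsOpenEmbedding f₂)
    {g₁ : OpenPartialHomeomorph M₁ P} {g₂ : OpenPartialHomeomorph M₂ P}
    (hs₁ : g₁.source = {f₁ 0}ᶜ) (hs₂ : g₂.source = {f₂ 0}ᶜ)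
    (hun : g₁.target ∪ g₂.target = univ)
    (hint : g₁.target ∩ g₂.target = (fun x => g₁ (f₁ x)) '' {0}ᶜ)
    (hrel : ∀ x : E3, x ≠ 0 → g₁ (f₁ x) = g₂ (f₂ ((‖x‖ ^ 2)⁻¹ • x)))
    {c₁ : M₁ → M₁ → G} {c₂ : M₂ → M₂ → G} (hc₁ : IsCocycleOn c₁ univ) (hc₂ : IsCocycleOn c₂ univ)
    (ht₁ : ∀ x ∈ range f₁, ∀ᶠ p in 𝓝 (x, x), c₁ p.1 p.2 = 1)
    (ht₂ : ∀ x ∈ range f₂, ∀ᶠ p in 𝓝 (x, x), c₂ p.1 p.2 = 1) :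
    ∃ c : P → P → G, IsCocycleOn c univ ∧ ∀ k A, ReducedOn c k A univ →
      ReducedOn c₁ (k ∘ g₁) A {f₁ 0}ᶜ ∧ ReducedOn c₂ (k ∘ g₂) A {f₂ 0}ᶜ := by
  obtain ⟨c, hc, h₁, h₂⟩ := exists_glue g₁.open_target g₂.open_target hun
    (hc₁.comp (g := g₁.symm) (fun y hy => g₁.continuousAt_symm hy) (fun _ _ => mem_univ _))
    (hc₂.comp (g := g₂.symm) (fun y hy => g₂.continuousAt_symm hy) (fun _ _ => mem_univ _)) (by
      intro x hx
      have e₁ : g₁.symm x ∈ range f₁ ∧ g₂.symm x ∈ range f₂ := by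
        have hx' := hx
        rw [hint] at hx'
        obtain ⟨y, hy, rfl⟩ := hx'
        have hy0 : y ≠ 0 := hy
        refine ⟨⟨y, (g₁.left_inv ?_).symm⟩, ⟨(‖y‖ ^ 2)⁻¹ • y, ?_⟩⟩
        · rw [hs₁]
          exact fun h => hy0 (hf₁.injective h)
        · simp only [hrel y hy0]
          refine (g₂.left_inv ?_).symm
          rw [hs₂]
          intro h
          have := hf₂.injective h
          simp [hy0] at this
      filter_upwards [eventually_diag_comp (g₁.continuousAt_symm hx.1) (ht₁ _ e₁.1),
        eventually_diag_comp (g₂.continuousAt_symm hx.2) (ht₂ _ e₁.2)] with p hp hp'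
      rw [hp, hp'])
  exact ⟨c, hc, fun k A hk => ⟨hs₁ ▸ hk.of_openPartialHomeomorph h₁,
    hs₂ ▸ hk.of_openPartialHomeomorph h₂⟩⟩

theorem isConnected_compl_zero : IsConnected ({0}ᶜ : Set E3) :=
  isConnected_compl_singleton_of_one_lt_rank (by
    rw [← Module.finrank_eq_rank, finrank_euclideanSpace_fin]; norm_num) 0

/-- A cocycle on `M₁`, gauged to be trivial on the ball, extends by the trivial cocycle on `M₂`. A
commutative reduction of the result would extend over the puncture of `M₁`, since a punctured ball
in dimension three is connected. -/
theorem IsConnectedSum.hasNonabelianCocycle (h : IsConnectedSum M₁ M₂ P)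
    (h₁ : HasNonabelianCocycle M₁ G) : HasNonabelianCocycle P G := by
  obtain ⟨c₁, hc₁, hirr⟩ := h₁
  obtain ⟨f₁, f₂, g₁, g₂, hf₁, hf₂, -, -, hs₁, hs₂, hun, hint, hrel⟩ := h
  have hf := hf₁.isOpenEmbedding
  obtain ⟨κ, -, hκ⟩ := hc₁.exists_gauge hf 0
  obtain ⟨c, hc, hck⟩ := exists_cocycle_connectedSum hf hf₂.isOpenEmbedding hs₁ hs₂ hun hint
    hrel (hc₁.gauge κ) (isCocycleOn_one univ) hκ (fun _ _ => by simp)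
  refine ⟨c, hc, fun k A hA hk => ?_⟩
  obtain ⟨k', hk'⟩ := (hck k A hk).1.exists_extend
    (trivializedBy_one_of_eventually hf.continuous hκ) hf.continuous hf.isOpenMap
    (fun y z hyz => ⟨id, continuous_id, fun _ => rfl, hf.injective hyz⟩) isClosed_singleton
    (singleton_subset_iff.2 ⟨0, rfl⟩) (by
      have : f₁ ⁻¹' {f₁ 0}ᶜ = {0}ᶜ := by ext x; simp [hf.injective.eq_iff]
      rw [this]
      exact isConnected_compl_zero)
  exact hirr _ A hA (reducedOn_gauge.1 hk')

/-- Otherwise an open map to the sphere would be constant, making a point clopen and hence equal to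
its antipode. The point `v` gives a circle that misses the puncture `f 0`. -/
theorem exists_snd_ne {X : Type*} [TopologicalSpace X]
    (Φ : X ≃ₜ Circle × Metric.sphere (0 : E3) 1) {f : E3 → X} (hf : IsOpenEmbedding f) :
    ∃ v, (Φ (f v)).2 ≠ (Φ (f 0)).2 := by
  by_contra! h
  have hrank : 1 < Module.rank ℝ E3 := by
    rw [← Module.finrank_eq_rank, finrank_euclideanSpace_fin]; norm_num
  have : PreconnectedSpace (Metric.sphere (0 : E3) 1) :=
    isPreconnected_iff_preconnectedSpace.1 (isPreconnected_sphere hrank 0 1)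
  have hopen : IsOpen (range fun v => (Φ (f v)).2) :=
    ((isOpenMap_snd.comp Φ.isOpenMap).comp hf.isOpenMap).isOpen_range
  have hr : (range fun v => (Φ (f v)).2) = {(Φ (f 0)).2} := by
    ext s
    simp only [mem_range, h, mem_singleton_iff, exists_const, eq_comm]
  rw [hr] at hopen
  have huniv := (isClopen_iff.1 ⟨isClosed_singleton, hopen⟩).resolve_left (singleton_ne_empty _)
  have hneg : -(Φ (f 0)).2 ∈ ({(Φ (f 0)).2} : Set (Metric.sphere (0 : E3) 1)) := by
    rw [huniv]; trivial
  have h2 : -((Φ (f 0)).2 : E3) = (Φ (f 0)).2 := congrArg Subtype.val hneg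
  have h3 : ((Φ (f 0)).2 : E3) = 0 := by
    have : (2 : ℝ) • ((Φ (f 0)).2 : E3) = 0 := by
      rw [two_smul]
      nth_rewrite 1 [← h2]
      exact neg_add_cancel _
    simpa using this
  have h4 := (Φ (f 0)).2.2
  rw [h3] at h4
  simp at h4

/-- The summands carry circles with holonomies `a` and `b`. A reduction to `A` puts a conjugate of
each in `A`; the two conjugators agree modulo `A` because the neck is connected and the cocycle is
trivial there. So one conjugation puts both in `A`, and they would commute. -/
theorem IsConnectedSum.hasNonabelianCocycle_of_isS1xS2 (h : IsConnectedSum M₁ M₂ P)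
    (h₁ : M₁.IsS1xS2) (h₂ : M₂.IsS1xS2) {a b : G} (hab : a * b ≠ b * a) :
    HasNonabelianCocycle P G := by
  obtain ⟨Φ₁⟩ := h₁
  obtain ⟨Φ₂⟩ := h₂
  obtain ⟨f₁, f₂, g₁, g₂, hf₁, hf₂, -, -, hs₁, hs₂, hun, hint, hrel⟩ := h
  have hf := hf₁.isOpenEmbedding
  have hf' := hf₂.isOpenEmbedding
  obtain ⟨v₁, hv₁⟩ := exists_snd_ne Φ₁ hf
  obtain ⟨v₂, hv₂⟩ := exists_snd_ne Φ₂ hf'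
  obtain ⟨c₁, hc₁, ht₁, hol₁⟩ := exists_cocycle_circle_prod Φ₁ hf hv₁ a
  obtain ⟨c₂, hc₂, ht₂, hol₂⟩ := exists_cocycle_circle_prod Φ₂ hf' hv₂ b
  obtain ⟨c, hc, hck⟩ := exists_cocycle_connectedSum hf hf' hs₁ hs₂ hun hint hrel hc₁ hc₂ ht₁ ht₂
  refine ⟨c, hc, fun k A hA hk => hab ?_⟩
  obtain ⟨hk₁, hk₂⟩ := hck k A hk
  have ha := hol₁ _ _ hk₁
  have hb := hol₂ _ _ hk₂
  have hv₁0 : v₁ ≠ 0 := by rintro rfl; exact hv₁ rfl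
  have hv₂0 : v₂ ≠ 0 := by rintro rfl; exact hv₂ rfl
  -- The inversion of `v₂`, so that `f₁ v₃` and `f₂ v₂` become the same point of the neck.
  let v₃ : E3 := (‖v₂‖ ^ 2)⁻¹ • v₂
  have hn : ‖v₂‖ ≠ 0 := norm_ne_zero_iff.2 hv₂0
  have hv₃0 : v₃ ≠ 0 := smul_ne_zero (inv_ne_zero (pow_ne_zero _ hn)) hv₂0
  have hv₃ : g₁ (f₁ v₃) = g₂ (f₂ v₂) := by
    rw [hrel _ hv₃0]
    congr 2
    simp only [v₃, norm_smul, smul_smul, norm_inv, norm_pow, norm_norm]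
    convert one_smul ℝ v₂ using 2
    field_simp
  have hcon := hk₁.inv_mul_mem (trivializedBy_one_of_eventually hf.continuous ht₁) hf.continuous
    isConnected_compl_zero.isPreconnected
    (fun y hy h => hy (hf.injective h)) (show v₁ ∈ {0}ᶜ from hv₁0) (show v₃ ∈ {0}ᶜ from hv₃0)
  simp only [Function.comp_apply, one_mul, hv₃] at ha hb hcon
  set x := k (g₁ (f₁ v₁))
  set y := k (g₂ (f₂ v₂))
  have hb' : x⁻¹ * b * x ∈ A := by
    convert A.mul_mem (A.mul_mem hcon hb) (A.inv_mem hcon) using 1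
    group
  have := hA _ ha _ hb'
  calc a * b = x * ((x⁻¹ * a * x) * (x⁻¹ * b * x)) * x⁻¹ := by group
    _ = b * a := by rw [this]; group

theorem IsTripleConnectedSumS1xS2.hasNonabelianCocycle (h : M.IsTripleConnectedSumS1xS2) {a b : G}
    (hab : a * b ≠ b * a) : HasNonabelianCocycle M G := by
  obtain ⟨X₁, X₂, X₃, Y, h₁, h₂, -, h₁₂, h₃⟩ := h
  exact h₃.hasNonabelianCocycle (h₁₂.hasNonabelianCocycle_of_isS1xS2 h₁ h₂ hab)

theorem IsThreeTorus.not_hasNonabelianCocycle (h : M.IsThreeTorus) :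
    ¬ HasNonabelianCocycle M G := by
  obtain ⟨Φ⟩ := h
  let e : ℝ × ℝ × ℝ → Circle × Circle × Circle :=
    Prod.map Circle.exp (Prod.map Circle.exp Circle.exp)
  refine not_hasNonabelianCocycle_of_lattice (π := Φ.symm ∘ e)
    (Φ.symm.continuous.comp (by fun_prop))
    (Φ.symm.isOpenMap.comp
      (isOpenMap_circleExp.prodMap (isOpenMap_circleExp.prodMap isOpenMap_circleExp)))
    (Φ.symm.surjective.comp (Circle.exp_surjective.prodMap
      (Circle.exp_surjective.prodMap Circle.exp_surjective))) ?_
  rintro ⟨v₁, v₂, v₃⟩ ⟨w₁, w₂, w₃⟩ h ⟨x₁, x₂, x₃⟩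
  have h' := Φ.symm.injective h
  simp only [e, Prod.map_apply, Prod.mk.injEq] at h'
  simp only [Function.comp_apply, e, Prod.map_apply, Prod.mk_sub_mk, Prod.mk_add_mk,
    Circle.exp_add, Circle.exp_sub, h'.1, h'.2.1, h'.2.2, div_self', mul_one]

theorem IsDehnSurgery.hasNonabelianCocycle_iff {q p : ℤ} (h : IsDehnSurgery q p M M')
    (hp : ∀ g : G, g ^ p = 1) : HasNonabelianCocycle M G ↔ HasNonabelianCocycle M' G := by
  obtain ⟨f, f', h, b, e, hf, hf', -, hs, ht, hdet, hrel⟩ := h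
  -- `ε` is the determinant of the gluing matrix, whose inverse is `ε` times its adjugate. The
  -- reverse surgery has longitudinal coefficient `-ε * p`, which still annihilates `G`.
  obtain ⟨ε, hε⟩ : ∃ ε : ℤ, ε * (q * e - b * p) = 1 := by
    rcases hdet with h | h
    · exact ⟨1, by rw [h]; rfl⟩
    · exact ⟨-1, by rw [h]; rfl⟩
  refine ⟨.of_surgery hf.isOpenEmbedding hf'.isOpenEmbedding h hs ht hp hrel,
    .of_surgery hf'.isOpenEmbedding hf.isOpenEmbedding h.symm ht hs (q := ε * e) (p := -ε * p)
      (b := -ε * b) (e := ε * q) (fun g => by rw [mul_comm, zpow_mul, hp, one_zpow]) ?_⟩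
  intro r u v hr
  rw [← hrel _ _ _ hr]
  have e₁ : (u ^ (ε * e) * v ^ (-ε * b)) ^ q * (u ^ (-ε * p) * v ^ (ε * q)) ^ b = u := by
    have h1 : ε * e * q + -ε * p * b = 1 := by linarith
    have h2 : -ε * b * q + ε * q * b = 0 := by ring
    rw [mul_zpow, mul_zpow, mul_mul_mul_comm]
    simp only [← zpow_mul, ← zpow_add, h1, h2, zpow_one, zpow_zero, mul_one]
  have e₂ : (u ^ (ε * e) * v ^ (-ε * b)) ^ p * (u ^ (-ε * p) * v ^ (ε * q)) ^ e = v := by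
    have h1 : ε * e * p + -ε * p * e = 0 := by ring
    have h2 : -ε * b * p + ε * q * e = 1 := by linarith
    rw [mul_zpow, mul_zpow, mul_mul_mul_comm]
    simp only [← zpow_mul, ← zpow_add, h1, h2, zpow_one, zpow_zero, one_mul]
  rw [e₁, e₂]
  refine h.left_inv ?_
  rw [hs]
  rintro ⟨w, hw, hfw⟩
  have h2 := congrArg Prod.fst (hf.1 hfw)
  rw [show w.1 = 0 from hw.1] at h2
  exact mul_ne_zero (by exact_mod_cast hr.ne') (Circle.coe_ne_zero _) h2.symm

theorem WeaklyCongruent.hasNonabelianCocycle_iff {d : ℕ} (h : WeaklyCongruent d M M')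
    (hd : ∀ g : G, g ^ d = 1) : HasNonabelianCocycle M G ↔ HasNonabelianCocycle M' G := by
  induction h with
  | rel M M' h =>
    rcases h with ⟨⟨Φ⟩⟩ | ⟨q, s, -, -, h⟩
    · exact ⟨.of_homeomorph Φ.toHomeomorph, .of_homeomorph Φ.toHomeomorph.symm⟩
    · exact h.hasNonabelianCocycle_iff fun g => by
        rw [zpow_mul, zpow_natCast, hd, one_zpow]
  | refl => rfl
  | symm _ _ _ ih => exact ih.symm
  | trans _ _ _ _ _ ih₁ ih₂ => exact ih₁.trans ih₂

end ClosedOriented3Manifold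

/-! ### Noncommutative groups of exponent dividing `d` -/

/-- The Heisenberg group over a commutative ring. -/
@[ext]
structure Heisenberg (R : Type*) where
  x : R
  y : R
  z : R

namespace Heisenberg

variable {R : Type*} [CommRing R]

instance : Mul (Heisenberg R) := ⟨fun a b => ⟨a.x + b.x, a.y + b.y, a.z + b.z + a.x * b.y⟩⟩

instance : One (Heisenberg R) := ⟨⟨0, 0, 0⟩⟩

instance : Inv (Heisenberg R) := ⟨fun a => ⟨-a.x, -a.y, -a.z + a.x * a.y⟩⟩

theorem mul_def (a b : Heisenberg R) :
    a * b = ⟨a.x + b.x, a.y + b.y, a.z + b.z + a.x * b.y⟩ := rfl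

theorem one_def : (1 : Heisenberg R) = ⟨0, 0, 0⟩ := rfl

theorem inv_def (a : Heisenberg R) : a⁻¹ = ⟨-a.x, -a.y, -a.z + a.x * a.y⟩ := rfl

instance : Group (Heisenberg R) :=
  Group.ofLeftAxioms (fun a b c => by simp only [mul_def]; ext <;> ring)
    (fun a => by simp only [mul_def, one_def]; ext <;> ring)
    (fun a => by simp only [mul_def, one_def, inv_def]; ext <;> ring)

theorem pow_eq (a : Heisenberg R) (n : ℕ) :
    a ^ n = ⟨n * a.x, n * a.y, n * a.z + n.choose 2 * (a.x * a.y)⟩ := by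
  induction n with
  | zero => simp [one_def]
  | succ n ih =>
    rw [pow_succ, ih, mul_def]
    have : (n + 1).choose 2 = n + n.choose 2 := by
      rw [Nat.choose_succ_succ' n 1, Nat.choose_one_right]
    rw [this]
    ext <;> push_cast <;> ring

end Heisenberg

/-- For `d = 2 * m` the dihedral group of order `2 * m` works, except that it is commutative when `m
= 2`; then the one of order `8` has exponent `4`. For odd `d` the Heisenberg group modulo `d` works.
For `d = 2` no such group exists. -/
theorem exists_noncommutative_group_pow_eq_one {d : ℕ} (hd : 2 < d) :
    ∃ (G : Type) (_ : Group G), (∀ g : G, g ^ d = 1) ∧ ∃ a b : G, a * b ≠ b * a := by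
  have dihedral : ∀ m, m ≠ 1 → m ≠ 2 → Nat.lcm m 2 ∣ d →
      ∃ (G : Type) (_ : Group G), (∀ g : G, g ^ d = 1) ∧ ∃ a b : G, a * b ≠ b * a :=
    fun m h1 h2 hm => by
      refine ⟨DihedralGroup m, inferInstance, fun g => ?_, ?_⟩
      · rw [show Nat.lcm m 2 = _ from DihedralGroup.exponent.symm] at hm
        exact Monoid.exponent_dvd_iff_forall_pow_eq_one.1 hm g
      · by_contra! h
        exact DihedralGroup.not_commutative h1 h2 ⟨⟨h⟩⟩
  rcases Nat.even_or_odd' d with ⟨m, rfl | rfl⟩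
  · by_cases h : m = 2
    · subst h
      exact dihedral 4 (by norm_num) (by norm_num) (by norm_num [Nat.lcm])
    · exact dihedral m (by lia) h (Nat.lcm_dvd (dvd_mul_left _ _) (dvd_mul_right _ _))
  -- Oddness makes the binomial coefficient in `Heisenberg.pow_eq` divisible by `d`.
  · have hc : (2 * m + 1).choose 2 = (2 * m + 1) * m := by
      rw [Nat.choose_two_right, Nat.add_sub_cancel, mul_left_comm,
        Nat.mul_div_cancel_left _ two_pos]
    have h0 : ((2 * m + 1 : ℕ) : ZMod (2 * m + 1)) = 0 := ZMod.natCast_self _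
    refine ⟨Heisenberg (ZMod (2 * m + 1)), inferInstance, fun g => ?_, ⟨1, 0, 0⟩, ⟨0, 1, 0⟩, ?_⟩
    · rw [Heisenberg.pow_eq, hc, Nat.cast_mul, h0, Heisenberg.one_def]
      simp
    · have : Fact (1 < 2 * m + 1) := ⟨by lia⟩
      intro h
      have := congrArg Heisenberg.z h
      simp [Heisenberg.mul_def] at this

theorem theorem1 (d : ℕ) (hd : 2 < d) (M N : ClosedOriented3Manifold)
    (hM : M.IsThreeTorus) (hN : N.IsTripleConnectedSumS1xS2) :
    ¬ ClosedOriented3Manifold.WeaklyCongruent d M N := by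
  obtain ⟨G, _, hG, a, b, hab⟩ := exists_noncommutative_group_pow_eq_one hd
  exact fun h => hM.not_hasNonabelianCocycle (G := G)
    ((h.hasNonabelianCocycle_iff hG).2 (hN.hasNonabelianCocycle hab))
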